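/- Let $n\ge 0$ and let $H_{2n+1}$ be the Heisenberg group, i.e. the Lie group with base manifold $\mathbb R^{2n}\times\mathbb R$ and multiplication $(x,s)\cdot(y,t)=(x+y,\,s+t+\omega(x,y))$, where $\omega$ is the standard symplectic form on $\mathbb R^{2n}$. Let $g$ be a smooth Riemannian metric and $X$ a smooth vector field on $H_{2n+1}$, not identically zero, with $\sqrt{g(X,X)}<1$ everywhere, and let $$F(p,y)=\sqrt{g_p(y,y)}+g_p(X(p),y),\qquad p\in H_{2n+1},\ y\in T_pH_{2n+1},$$ be the associated (non-Riemannian) Randers metric, which is a Finsler metric. Suppose that $F$ is left-invariant, i.e. $F(a,v)=F(e,(L_{a^{-1}})_*v)$ for all $a\in H_{2n+1}$ and $v\in T_aH_{2n+1}$, and of Douglas type, i.e. the $1$-form $g(X,\cdot)$ is closed. Then the Finsler space $(H_{2n+1},F)$ is not weakly symmetric. Here a connected Finsler space $(M,F)$ is called weakly symmetric if for any two points $p,q\in M$ there is an isometry $\phi$ of $(M,F)$ (a diffeomorphism of $M$ with $F(\phi(x),d\phi_x(y))=F(x,y)$ for all $(x,y)\in TM$) such that $\phi(p)=q$ and $\phi(q)=p$.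 -/

import Mathlib

open scoped Manifold ContDiff

noncomputable section

section Finsler

/-- A Finsler metric on a manifold `M`: a function `F : TM → [0, ∞)` which is smooth on the slit
tangent bundle, positively homogeneous on each tangent space, and strongly convex, i.e. the
fundamental form `g_y (w, w) = ½ d²/dt² F²(y + t w) |_{t = 0}` is positive definite for every
`y ≠ 0`. -/
structure FinslerMetric {E : Type*} [NormedAddCommGroup E] [NormedSpace ℝ E]
    {H : Type*} [TopologicalSpace H] (I : ModelWithCorners ℝ E H)
    (M : Type*) [TopologicalSpace M] [ChartedSpace H M] [IsManifold I ∞ M] where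
  toFun : TangentBundle I M → ℝ
  nonneg : ∀ v, 0 ≤ toFun v
  smooth : ContMDiffOn I.tangent 𝓘(ℝ, ℝ) ∞ toFun {v | v.2 ≠ 0}
  homogeneous : ∀ (x : M) (y : TangentSpace I x) (c : ℝ), 0 < c →
    toFun ⟨x, c • y⟩ = c * toFun ⟨x, y⟩
  strongly_convex : ∀ (x : M) (y w : TangentSpace I x), y ≠ 0 → w ≠ 0 →
    0 < iteratedDeriv 2 (fun t : ℝ ↦ (1 / 2 : ℝ) * toFun ⟨x, y + t • w⟩ ^ 2) 0

theorem randers_convexity_aux (A B C d e : ℝ) (hA : 0 < A) (hBC : B ^ 2 ≤ A * C)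
    (hd : |d| < √A) (he : |e| < √C) :
    0 < iteratedDeriv 2 (fun t : ℝ ↦
      (1 / 2 : ℝ) * (√(A + 2 * t * B + t ^ 2 * C) + (d + t * e)) ^ 2) 0 := by
  have hP (t : ℝ) : HasDerivAt (fun t : ℝ ↦ A + 2 * t * B + t ^ 2 * C) (2 * B + 2 * t * C) t := by
    have := (((hasDerivAt_id t).const_mul 2).mul_const B).const_add A |>.add
      (((hasDerivAt_id t).pow 2).mul_const C)
    exact this.congr_deriv (by simp)
  have hS (t : ℝ) (ht : A + 2 * t * B + t ^ 2 * C ≠ 0) :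
      HasDerivAt (fun t : ℝ ↦ √(A + 2 * t * B + t ^ 2 * C))
        ((B + t * C) / √(A + 2 * t * B + t ^ 2 * C)) t := by
    convert (hP t).sqrt ht using 1
    rw [show 2 * B + 2 * t * C = 2 * (B + t * C) by ring, mul_div_mul_left _ _ two_ne_zero]
  have hL (t : ℝ) : HasDerivAt (fun t : ℝ ↦ d + t * e) e t := by
    simpa using ((hasDerivAt_id t).mul_const e).const_add d
  have hF (t : ℝ) (ht : A + 2 * t * B + t ^ 2 * C ≠ 0) :
      HasDerivAt (fun t : ℝ ↦ (1 / 2 : ℝ) * (√(A + 2 * t * B + t ^ 2 * C) + (d + t * e)) ^ 2)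
        ((√(A + 2 * t * B + t ^ 2 * C) + (d + t * e)) *
          ((B + t * C) / √(A + 2 * t * B + t ^ 2 * C) + e)) t := by
    exact ((((hS t ht).add (hL t)).pow 2).const_mul (1 / 2 : ℝ)).congr_deriv (by
      simp only [Pi.add_apply]; ring)
  have hne : ∀ᶠ t in nhds (0 : ℝ), A + 2 * t * B + t ^ 2 * C ≠ 0 :=
    (hP 0).continuousAt.eventually_ne (by simpa using hA.ne')
  have hev : deriv (fun t : ℝ ↦ (1 / 2 : ℝ) * (√(A + 2 * t * B + t ^ 2 * C) + (d + t * e)) ^ 2)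
      =ᶠ[nhds 0] fun t ↦ (√(A + 2 * t * B + t ^ 2 * C) + (d + t * e)) *
          ((B + t * C) / √(A + 2 * t * B + t ^ 2 * C) + e) := by
    filter_upwards [hne] with t ht using (hF t ht).deriv
  rw [iteratedDeriv_succ, iteratedDeriv_one, hev.deriv_eq]
  have h0 : A + 2 * (0 : ℝ) * B + 0 ^ 2 * C = A := by ring
  have hs : 0 < √A := Real.sqrt_pos.2 hA
  have hss : √A ^ 2 = A := Real.sq_sqrt hA.le
  have hlin : HasDerivAt (fun t : ℝ ↦ B + t * C) C 0 := by
    simpa using ((hasDerivAt_id (0 : ℝ)).mul_const C).const_add B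
  have hS0 := hS 0 (by rw [h0]; exact hA.ne')
  have h2 := (hS0.add (hL 0)).mul ((hlin.div hS0 (by rw [h0]; exact hs.ne')).add_const e)
  have h3 := h2.deriv
  simp only [Pi.add_apply, Pi.div_apply] at h3
  have h3' := (Filter.EventuallyEq.deriv_eq (f := fun t : ℝ ↦
    (√(A + 2 * t * B + t ^ 2 * C) + (d + t * e)) *
      ((B + t * C) / √(A + 2 * t * B + t ^ 2 * C) + e)) (Filter.EventuallyEq.refl _ _)).trans h3
  rw [h3']
  simp only [h0, zero_mul, add_zero, hss]
  have hsd : 0 < √A + d := by linarith [(abs_lt.1 hd).1]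
  have hK : (C * √A - B * (B / √A)) / A = (A * C - B ^ 2) / (A * √A) := by
    rw [div_eq_div_iff hA.ne' (by positivity)]
    field_simp
    rw [hss]
  rw [hK]
  rcases hBC.lt_or_eq with h | h
  · have : 0 < (A * C - B ^ 2) / (A * √A) := div_pos (by linarith) (by positivity)
    nlinarith [sq_nonneg (B / √A + e), mul_pos hsd this]
  · have hz : (A * C - B ^ 2) / (A * √A) = 0 := by rw [h]; simp
    rw [hz]
    have hC : (B / √A) ^ 2 = C := by
      rw [div_pow, hss, h]; field_simp
    have hCe : e ^ 2 < C := by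
      have := Real.lt_sqrt (abs_nonneg e) |>.1 he
      rwa [sq_abs] at this
    have : B / √A + e ≠ 0 := by
      intro h'
      have : B / √A = -e := by linarith
      rw [this] at hC
      nlinarith
    have := sq_pos_of_ne_zero this
    nlinarith

/-- The data of a Randers metric on a manifold: a Riemannian metric `g` and a smooth vector
field `X` with `√(g(X, X)) < 1` everywhere. -/
structure RandersData {E : Type*} [NormedAddCommGroup E] [NormedSpace ℝ E]
    {H : Type*} [TopologicalSpace H] (I : ModelWithCorners ℝ E H)
    (M : Type*) [TopologicalSpace M] [ChartedSpace H M] [IsManifold I ∞ M] where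
  metric : Bundle.ContMDiffRiemannianMetric I ∞ E (fun x : M ↦ TangentSpace I x)
  field : ∀ x : M, TangentSpace I x
  field_smooth : ContMDiff I I.tangent ∞ (fun x ↦ (⟨x, field x⟩ : TangentBundle I M))
  norm_lt_one : ∀ x, √(metric.inner x (field x) (field x)) < 1

variable {E : Type*} [NormedAddCommGroup E] [NormedSpace ℝ E]
  {H : Type*} [TopologicalSpace H] {I : ModelWithCorners ℝ E H}
  {M : Type*} [TopologicalSpace M] [ChartedSpace H M] [IsManifold I ∞ M]

namespace RandersData

/-- `F(x, y) = √(g(y, y)) + g(X(x), y)`. -/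
def norm (R : RandersData I M) (v : TangentBundle I M) : ℝ :=
  √(R.metric.inner v.1 v.2 v.2) + R.metric.inner v.1 (R.field v.1) v.2

/-- The `1`-form `g(X, ·)`. -/
def oneForm (R : RandersData I M) (x : M) : TangentSpace I x →L[ℝ] ℝ :=
  R.metric.inner x (R.field x)

theorem inner_self_pos (R : RandersData I M) (x : M) (y : TangentSpace I x) (hy : y ≠ 0) :
    0 < R.metric.inner x y y := R.metric.pos x y hy

theorem inner_self_nonneg (R : RandersData I M) (x : M) (y : TangentSpace I x) :
    0 ≤ R.metric.inner x y y := by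
  rcases eq_or_ne y 0 with rfl | hy
  · simp
  · exact (R.metric.pos x y hy).le

theorem inner_expand (R : RandersData I M) (x : M) (y w : TangentSpace I x) (t : ℝ) :
    R.metric.inner x (y + t • w) (y + t • w) =
      R.metric.inner x y y + 2 * t * R.metric.inner x y w + t ^ 2 * R.metric.inner x w w := by
  have := R.metric.symm x y w
  simp only [map_add, map_smul, add_apply, smul_apply,
    smul_eq_mul]
  rw [this]; ring

theorem cauchy_schwarz (R : RandersData I M) (x : M) (y w : TangentSpace I x) :
    R.metric.inner x y w ^ 2 ≤ R.metric.inner x y y * R.metric.inner x w w := by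
  have h : ∀ t : ℝ, 0 ≤ R.metric.inner x w w * (t * t) + 2 * R.metric.inner x y w * t +
      R.metric.inner x y y := fun t ↦ by
    have := R.inner_self_nonneg x (y + t • w)
    rw [R.inner_expand] at this
    nlinarith
  have := discrim_le_zero h
  unfold discrim at this
  nlinarith

theorem abs_oneForm_lt (R : RandersData I M) (x : M) (y : TangentSpace I x) (hy : y ≠ 0) :
    |R.metric.inner x (R.field x) y| < √(R.metric.inner x y y) := by
  have h1 := R.cauchy_schwarz x (R.field x) y
  have h2 : R.metric.inner x (R.field x) (R.field x) < 1 := by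
    have := R.norm_lt_one x
    rwa [Real.sqrt_lt' one_pos, one_pow] at this
  have h3 := R.metric.pos x y hy
  apply Real.lt_sqrt_of_sq_lt
  rw [sq_abs]
  nlinarith

theorem norm_pos (R : RandersData I M) (x : M) (y : TangentSpace I x) (hy : y ≠ 0) :
    0 < R.norm ⟨x, y⟩ := by
  have := (abs_lt.1 (R.abs_oneForm_lt x y hy)).1
  simp only [norm]
  linarith

theorem norm_nonneg (R : RandersData I M) (v : TangentBundle I M) : 0 ≤ R.norm v := by
  obtain ⟨x, y⟩ := v
  rcases eq_or_ne y 0 with rfl | hy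
  · simp [norm]
  · exact (R.norm_pos x y hy).le

theorem norm_homogeneous (R : RandersData I M) (x : M) (y : TangentSpace I x) (c : ℝ)
    (hc : 0 < c) : R.norm ⟨x, c • y⟩ = c * R.norm ⟨x, y⟩ := by
  simp only [norm, map_smul, smul_apply, smul_eq_mul]
  rw [← mul_assoc, Real.sqrt_mul (mul_self_nonneg c), Real.sqrt_mul_self hc.le]
  ring

theorem norm_smooth (R : RandersData I M) :
    ContMDiffOn I.tangent 𝓘(ℝ, ℝ) ∞ R.norm {v | v.2 ≠ 0} := by
  have hid : ContMDiff I.tangent I.tangent ∞ (fun v : TangentBundle I M ↦ v) := contMDiff_id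
  have hproj : ContMDiff I.tangent I ∞ (fun v : TangentBundle I M ↦ v.1) :=
    Bundle.contMDiff_proj _
  have hg := R.metric.contMDiff.comp hproj
  have hX := R.field_smooth.comp hproj
  have key (w : ∀ v : TangentBundle I M, TangentSpace I v.1)
      (hw : ContMDiff I.tangent I.tangent ∞
        (fun v ↦ (⟨v.1, w v⟩ : TangentBundle I M))) :
      ContMDiff I.tangent 𝓘(ℝ, ℝ) ∞ (fun v : TangentBundle I M ↦ R.metric.inner v.1 (w v) v.2) := by
    intro v
    have : ContMDiffAt I.tangent (I.prod 𝓘(ℝ)) ∞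
        (fun m : TangentBundle I M ↦ Bundle.TotalSpace.mk' ℝ (E := Bundle.Trivial M ℝ) m.1
          (R.metric.inner m.1 (w m) m.2)) v := by
      apply ContMDiffAt.clm_bundle_apply₂ (F₁ := E) (F₂ := E)
      · exact hg v
      · exact hw v
      · exact hid v
    rw [Bundle.contMDiffAt_totalSpace] at this
    exact this.2
  have h1 := key (fun v ↦ v.2) hid
  have h2 := key (fun v ↦ R.field v.1) hX
  intro v hv
  have hs : ContMDiffAt 𝓘(ℝ, ℝ) 𝓘(ℝ, ℝ) ∞ Real.sqrt (R.metric.inner v.1 v.2 v.2) :=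
    (Real.contDiffAt_sqrt (R.metric.pos v.1 v.2 hv).ne').contMDiffAt
  have h3 := hs.comp v (h1 v)
  exact (h3.add (h2 v)).contMDiffWithinAt

theorem norm_strongly_convex (R : RandersData I M) (x : M) (y w : TangentSpace I x)
    (hy : y ≠ 0) (hw : w ≠ 0) :
    0 < iteratedDeriv 2 (fun t : ℝ ↦ (1 / 2 : ℝ) * R.norm ⟨x, y + t • w⟩ ^ 2) 0 := by
  have hA := R.metric.pos x y hy
  have hBC := R.cauchy_schwarz x y w
  have := randers_convexity_aux _ _ _ _ _ hA hBC (R.abs_oneForm_lt x y hy)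
    (R.abs_oneForm_lt x w hw)
  have h (t : ℝ) : R.norm ⟨x, y + t • w⟩ =
      √(R.metric.inner x y y + 2 * t * R.metric.inner x y w + t ^ 2 * R.metric.inner x w w) +
        (R.metric.inner x (R.field x) y + t * R.metric.inner x (R.field x) w) := by
    rw [← R.inner_expand]
    simp only [norm, map_add, map_smul, smul_eq_mul]
  simpa only [h] using this

/-- The Randers metric, as a Finsler metric. -/
def toFinslerMetric (R : RandersData I M) : FinslerMetric I M where
  toFun := R.norm
  nonneg := R.norm_nonneg
  smooth := R.norm_smooth
  homogeneous := R.norm_homogeneous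
  strongly_convex := R.norm_strongly_convex

end RandersData

/-- A `1`-form `β` on `M` is closed if
`dβ(U, V) = U(β(V)) - V(β(U)) - β([U, V])` vanishes for all smooth vector fields `U`, `V`. -/
def IsClosedOneForm (β : ∀ x : M, TangentSpace I x →L[ℝ] ℝ) : Prop :=
  ∀ U V : ∀ x : M, TangentSpace I x,
    ContMDiff I I.tangent ∞ (fun x ↦ (⟨x, U x⟩ : TangentBundle I M)) →
    ContMDiff I I.tangent ∞ (fun x ↦ (⟨x, V x⟩ : TangentBundle I M)) →
    ∀ x : M,
      mvfderiv I (fun y ↦ β y (V y)) x (U x) - mvfderiv I (fun y ↦ β y (U y)) x (V x)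
        - β x (VectorField.mlieBracket I U V x) = 0

/-- A Randers metric is of Douglas type if the `1`-form `g(X, ·)` is closed. -/
def RandersData.IsDouglas (R : RandersData I M) : Prop := IsClosedOneForm R.oneForm

namespace FinslerMetric

/-- An isometry of `(M, F)`: a diffeomorphism `φ` of `M` with `F(φ(x), dφ_x(y)) = F(x, y)`. -/
def IsIsometry (F : FinslerMetric I M) (φ : M ≃ₘ^∞⟮I, I⟯ M) : Prop :=
  ∀ v : TangentBundle I M, F.toFun (tangentMap I I φ v) = F.toFun v

/-- A connected Finsler space `(M, F)` is weakly symmetric if any two points of `M` can be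
interchanged by an isometry. -/
def IsWeaklySymmetric [ConnectedSpace M] (F : FinslerMetric I M) : Prop :=
  ∀ p q : M, ∃ φ : M ≃ₘ^∞⟮I, I⟯ M, F.IsIsometry φ ∧ φ p = q ∧ φ q = p

/-- A Finsler metric on a Lie group is left-invariant if `F(a, v) = F(e, (L_{a⁻¹})_* v)` for all
`a` and all tangent vectors `v` at `a`. -/
def IsLeftInvariant {G : Type*} [TopologicalSpace G] [ChartedSpace H G] [Group G]
    [LieGroup I ∞ G] (F : FinslerMetric I G) : Prop :=
  ∀ v : TangentBundle I G, F.toFun v = F.toFun (tangentMap I I (fun b ↦ v.1⁻¹ * b) v)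

end FinslerMetric

end Finsler

section Heisenberg

/-- The vector space `ℝ²ⁿ × ℝ` on which the Heisenberg group is modelled. -/
abbrev HeisenbergModel (n : ℕ) : Type := ((Fin n → ℝ) × (Fin n → ℝ)) × ℝ

/-- The Heisenberg group `H_{2n+1}`, with base manifold `ℝ²ⁿ × ℝ`. -/
def Heisenberg (n : ℕ) : Type := HeisenbergModel n

namespace Heisenberg

variable {n : ℕ}

instance : TopologicalSpace (Heisenberg n) := inferInstanceAs (TopologicalSpace (HeisenbergModel n))

instance : ChartedSpace (HeisenbergModel n) (Heisenberg n) :=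
  inferInstanceAs (ChartedSpace (HeisenbergModel n) (HeisenbergModel n))

instance : IsManifold 𝓘(ℝ, HeisenbergModel n) ∞ (Heisenberg n) :=
  inferInstanceAs (IsManifold 𝓘(ℝ, HeisenbergModel n) ∞ (HeisenbergModel n))

instance : ConnectedSpace (Heisenberg n) := inferInstanceAs (ConnectedSpace (HeisenbergModel n))

/-- The standard symplectic form on `ℝ²ⁿ`. -/
def symplecticForm (x y : (Fin n → ℝ) × (Fin n → ℝ)) : ℝ :=
  ∑ i, (x.1 i * y.2 i - x.2 i * y.1 i)

/-- `(x, s) · (y, t) = (x + y, s + t + ω(x, y))`. -/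
instance : Group (Heisenberg n) where
  mul a b := (a.1 + b.1, a.2 + b.2 + symplecticForm a.1 b.1)
  one := (0, 0)
  inv a := (-a.1, -a.2)
  mul_assoc a b c := by
    refine Prod.ext (add_assoc a.1 b.1 c.1) ?_
    change a.2 + b.2 + symplecticForm a.1 b.1 + c.2 + symplecticForm (a.1 + b.1) c.1 =
      a.2 + (b.2 + c.2 + symplecticForm b.1 c.1) + symplecticForm a.1 (b.1 + c.1)
    have h1 : symplecticForm (a.1 + b.1) c.1 = symplecticForm a.1 c.1 + symplecticForm b.1 c.1 := by
      simp only [symplecticForm, ← Finset.sum_add_distrib]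
      exact Finset.sum_congr rfl fun i _ ↦ by simp; ring
    have h2 : symplecticForm a.1 (b.1 + c.1) = symplecticForm a.1 b.1 + symplecticForm a.1 c.1 := by
      simp only [symplecticForm, ← Finset.sum_add_distrib]
      exact Finset.sum_congr rfl fun i _ ↦ by simp; ring
    rw [h1, h2]; ring
  one_mul a := by
    refine Prod.ext (zero_add a.1) ?_
    change 0 + a.2 + symplecticForm 0 a.1 = a.2
    simp [symplecticForm]
  mul_one a := by
    refine Prod.ext (add_zero a.1) ?_
    change a.2 + 0 + symplecticForm a.1 0 = a.2
    simp [symplecticForm]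
  inv_mul_cancel a := by
    refine Prod.ext (neg_add_cancel a.1) ?_
    change -a.2 + a.2 + symplecticForm (-a.1) a.1 = 0
    have : symplecticForm (-a.1) a.1 = 0 := by
      unfold symplecticForm
      exact Finset.sum_eq_zero fun i _ ↦ by simp; ring
    rw [this]; ring

instance : LieGroup 𝓘(ℝ, HeisenbergModel n) ∞ (Heisenberg n) where
  contMDiff_mul := by
    have h : ContDiff ℝ ∞ (fun p : HeisenbergModel n × HeisenbergModel n ↦
        ((p.1.1 + p.2.1, p.1.2 + p.2.2 + symplecticForm p.1.1 p.2.1) : HeisenbergModel n)) := by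
      unfold symplecticForm
      fun_prop
    have h' := h.contMDiff
    rw [modelWithCornersSelf_prod, ← chartedSpaceSelf_prod] at h'
    exact h'
  contMDiff_inv := by
    have h : ContDiff ℝ ∞ (fun p : HeisenbergModel n ↦ ((-p.1, -p.2) : HeisenbergModel n)) := by
      fun_prop
    exact h.contMDiff

end Heisenberg

end Heisenberg

end

/-! Write β = g(X, ·). The part of F that is odd in y is β, so every isometry of F preserves β, and
left-invariance of F passes to β. In the global coordinates β at a is then its value at the identity
plus ω(·, a) β(0, 1), where (0, 1) is the central direction. Closedness evaluated on constant
coordinate fields kills the correction term, so β is a constant linear form b, which is its own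
potential (`oneForm_eq_oneForm_one`).

An isometry φ therefore satisfies b ∘ φ = b + c for some constant c
(`exists_apply_eq_add_of_comp_fderiv_eq`): it translates the potential and cannot reflect it. If φ
exchanges 0 and q, then b(q) = c and 0 = b(q) + c, hence b(q) = 0. As q is arbitrary, b = 0 and X =
0. -/

noncomputable section

/-! ### Isometries and the 1-form of a Randers metric -/

section Randers

variable {E : Type*} [NormedAddCommGroup E] [NormedSpace ℝ E]
  {H : Type*} [TopologicalSpace H] {I : ModelWithCorners ℝ E H}
  {M : Type*} [TopologicalSpace M] [ChartedSpace H M] [IsManifold I ∞ M]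

/-- The `1`-form of a Randers metric is the odd part of the norm. -/
theorem RandersData.norm_sub_norm_neg (R : RandersData I M) (x : M) (y : TangentSpace I x) :
    R.norm ⟨x, y⟩ - R.norm ⟨x, -y⟩ = 2 * R.oneForm x y := by
  simp only [RandersData.norm, RandersData.oneForm, map_neg, neg_apply, neg_neg]
  ring

/-- A map whose differential at `x` preserves the Randers norm preserves the `1`-form at `x`. -/
theorem RandersData.oneForm_mfderiv (R : RandersData I M) (φ : M → M) (x : M)
    (hφ : ∀ y : TangentSpace I x, R.norm (tangentMap I I φ ⟨x, y⟩) = R.norm ⟨x, y⟩)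
    (y : TangentSpace I x) :
    R.oneForm (φ x) (mfderiv I I φ x y) = R.oneForm x y := by
  have h1 : R.norm ⟨φ x, mfderiv I I φ x y⟩ = R.norm ⟨x, y⟩ := hφ y
  have h2 : R.norm ⟨φ x, mfderiv I I φ x (-y)⟩ = R.norm ⟨x, -y⟩ := hφ (-y)
  -- Linearity of `mfderiv` is all that is used about φ here; it holds even without
  -- differentiability, where the default value is zero.
  rw [map_neg] at h2
  have h3 := R.norm_sub_norm_neg (φ x) (mfderiv I I φ x y)
  have h4 := R.norm_sub_norm_neg x y
  linarith

/-- Nondegeneracy of g: evaluating g(X, ·) on X itself gives g(X, X) = 0. -/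
theorem RandersData.field_eq_zero_of_oneForm (R : RandersData I M) (h : ∀ x, R.oneForm x = 0) :
    R.field = 0 := by
  funext x
  by_contra hx
  have h1 := R.metric.pos x (R.field x) hx
  have h2 : R.metric.inner x (R.field x) (R.field x) = 0 :=
    congrArg (fun β : TangentSpace I x →L[ℝ] ℝ ↦ β (R.field x)) (h x)
  exact h1.ne' h2

end Randers

/-! ### Calculus in a global chart -/

/-- A self-map of a normed space that preserves a constant `1`-form preserves its potential up to a
constant. -/
theorem exists_apply_eq_add_of_comp_fderiv_eq {E : Type*} [NormedAddCommGroup E] [NormedSpace ℝ E]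
    (b : E →L[ℝ] ℝ) (φ : E → E) (hφ : Differentiable ℝ φ)
    (h : ∀ x y, b (fderiv ℝ φ x y) = b y) : ∃ c, ∀ x, b (φ x) = b x + c := by
  refine ⟨b (φ 0) - b 0, fun x ↦ ?_⟩
  have hd : ∀ x, HasFDerivAt (fun x ↦ b (φ x) - b x) (0 : E →L[ℝ] ℝ) x := fun x ↦ by
    refine ((b.hasFDerivAt.comp x (hφ x).hasFDerivAt).sub b.hasFDerivAt).congr_fderiv ?_
    ext y
    simp [h]
  have := is_const_of_fderiv_eq_zero (fun x ↦ (hd x).differentiableAt) (fun x ↦ (hd x).fderiv) x 0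
  linarith

/-- On the model space the bracket is the vector-space one, and both of its terms differentiate a
constant. This removes the bracket term from dβ. -/
theorem mlieBracket_const_const {E : Type*} [NormedAddCommGroup E] [NormedSpace ℝ E] (u v x : E) :
    VectorField.mlieBracket 𝓘(ℝ, E) (M := E) (fun _ ↦ u) (fun _ ↦ v) x = 0 := by
  have h (V W : ∀ x : E, TangentSpace 𝓘(ℝ, E) x) :
      VectorField.mlieBracket 𝓘(ℝ, E) V W = VectorField.lieBracket ℝ V W := by
    rw [← VectorField.mlieBracketWithin_univ, VectorField.mlieBracketWithin_eq_lieBracketWithin]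
    exact VectorField.lieBracketWithin_univ
  refine (congrFun (h (fun _ ↦ u) (fun _ ↦ v)) x).trans ?_
  have h0 : VectorField.lieBracket ℝ (fun _ : E ↦ u) (fun _ ↦ v) x = 0 := by
    simp [VectorField.lieBracket_eq]
  exact h0

theorem mvfderiv_apply_eq_fderiv {E : Type*} [NormedAddCommGroup E] [NormedSpace ℝ E] (f : E → ℝ)
    (x u : E) : mvfderiv 𝓘(ℝ, E) f x u = fderiv ℝ f x u := by
  rw [mvfderiv, mfderiv_eq_fderiv]
  rfl

/-! ### Closed left-invariant 1-forms on the Heisenberg group -/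

namespace Heisenberg

variable {n : ℕ}

/-- The symplectic form with its second argument fixed, as a linear form on the group. -/
def symplecticLeft (v : HeisenbergModel n) : HeisenbergModel n →L[ℝ] ℝ :=
  LinearMap.toContinuousLinearMap
    { toFun := fun x ↦ symplecticForm x.1 v.1
      map_add' := fun x y ↦ by
        simp only [symplecticForm, ← Finset.sum_add_distrib]
        exact Finset.sum_congr rfl fun i _ ↦ by simp; ring
      map_smul' := fun c x ↦ by
        simp only [symplecticForm, Finset.smul_sum, RingHom.id_apply]
        exact Finset.sum_congr rfl fun i _ ↦ by simp; ring }

theorem symplecticLeft_apply (u v : HeisenbergModel n) :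
    symplecticLeft v u = symplecticForm u.1 v.1 := rfl

theorem symplecticForm_swap (x y : (Fin n → ℝ) × (Fin n → ℝ)) :
    symplecticForm x y = -symplecticForm y x := by
  simp only [symplecticForm, ← Finset.sum_neg_distrib]
  exact Finset.sum_congr rfl fun i _ ↦ by ring

theorem symplecticForm_neg_right (x y : (Fin n → ℝ) × (Fin n → ℝ)) :
    symplecticForm x (-y) = -symplecticForm x y := by
  simp only [symplecticForm, ← Finset.sum_neg_distrib]
  exact Finset.sum_congr rfl fun i _ ↦ by simp; ring

/-- Left translation is affine in the coordinates of the group. -/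
theorem mfderiv_mul_left (a b : Heisenberg n) (v : HeisenbergModel n) :
    mfderiv 𝓘(ℝ, HeisenbergModel n) 𝓘(ℝ, HeisenbergModel n) (fun b : Heisenberg n ↦ a * b) b v =
      ((v.1, v.2 + symplecticForm a.1 v.1) : HeisenbergModel n) := by
  -- The linear part of b ↦ a * b. Since `symplecticLeft a` is ω(·, a), the minus sign produces ω(a,
  -- ·).
  let L : HeisenbergModel n →L[ℝ] HeisenbergModel n :=
    (ContinuousLinearMap.fst ℝ _ _).prod (ContinuousLinearMap.snd ℝ _ _ - symplecticLeft a)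
  have hL : (fun b : Heisenberg n ↦ a * b) = fun b : HeisenbergModel n ↦ L b + (a.1, a.2) := by
    funext b
    refine Prod.ext (add_comm a.1 b.1) ?_
    change a.2 + b.2 + symplecticForm a.1 b.1 = b.2 - symplecticForm b.1 a.1 + a.2
    rw [symplecticForm_swap b.1]
    ring
  have h : HasFDerivAt (fun b : HeisenbergModel n ↦ L b + (a.1, a.2)) L b :=
    L.hasFDerivAt.add_const _
  have h1 := DFunLike.congr_fun
    ((mfderiv_eq_fderiv (f := fun b : HeisenbergModel n ↦ L b + (a.1, a.2))).trans h.fderiv) v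
  rw [hL]
  refine h1.trans (Prod.ext rfl ?_)
  change v.2 - symplecticForm v.1 a.1 = v.2 + symplecticForm a.1 v.1
  rw [symplecticForm_swap v.1]
  ring

/-- The `1`-form of a left-invariant Randers metric is determined by its value at the identity. -/
theorem oneForm_apply_of_isLeftInvariant (R : RandersData 𝓘(ℝ, HeisenbergModel n) (Heisenberg n))
    (hinv : R.toFinslerMetric.IsLeftInvariant) (a : Heisenberg n) (v : HeisenbergModel n) :
    R.oneForm a v = R.oneForm 1 v + symplecticForm v.1 a.1 * R.oneForm 1 (0, 1) := by
  -- Translation by a⁻¹ carries a to the identity; the invariance hypothesis is needed only at the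
  -- base point a.
  have h := R.oneForm_mfderiv (fun b ↦ a⁻¹ * b) a (fun y ↦ (hinv ⟨a, y⟩).symm) v
  rw [mfderiv_mul_left, inv_mul_cancel] at h
  rw [← h]
  -- The translated vector differs from v by a central one, with coefficient ω(-a, v) = ω(v, a).
  have hs : ((v.1, v.2 + symplecticForm a⁻¹.1 v.1) : HeisenbergModel n) =
      v + symplecticForm v.1 a.1 • ((0, 1) : HeisenbergModel n) := by
    refine Prod.ext (by simp) ?_
    have : symplecticForm a⁻¹.1 v.1 = symplecticForm v.1 a.1 := by
      rw [symplecticForm_swap]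
      change -symplecticForm v.1 (-a.1) = _
      rw [symplecticForm_neg_right, neg_neg]
    simp [this]
  rw [hs]
  exact (map_add (R.oneForm 1 : HeisenbergModel n →L[ℝ] ℝ) _ _).trans
    (congrArg _ (map_smul (R.oneForm 1 : HeisenbergModel n →L[ℝ] ℝ) _ _))

/-- Closedness forces a left-invariant `1`-form to vanish on commutators. -/
theorem symplecticForm_mul_oneForm_eq_zero
    (R : RandersData 𝓘(ℝ, HeisenbergModel n) (Heisenberg n))
    (hinv : R.toFinslerMetric.IsLeftInvariant) (hDouglas : R.IsDouglas)
    (u v : HeisenbergModel n) :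
    symplecticForm u.1 v.1 * R.oneForm 1 (0, 1) = 0 := by
  -- Test closedness on the constant fields u and v: dβ(u, v) = -2 ω(u, v) β(0, 1). Keeping the
  -- conclusion as a product also covers n = 0, where ω vanishes and β(0, 1) need not.
  have hsmooth (w : HeisenbergModel n) :
      ContMDiff 𝓘(ℝ, HeisenbergModel n) 𝓘(ℝ, HeisenbergModel n).tangent ∞
        (fun x : HeisenbergModel n ↦
          (⟨x, w⟩ : TangentBundle 𝓘(ℝ, HeisenbergModel n) (HeisenbergModel n))) :=
    contMDiff_vectorSpace_iff_contDiff.2 contDiff_const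
  have hderiv (w z x : HeisenbergModel n) :
      mvfderiv 𝓘(ℝ, HeisenbergModel n) (fun y : HeisenbergModel n ↦ R.oneForm y w) x z =
        -(symplecticForm z.1 w.1 * R.oneForm 1 (0, 1)) := by
    -- The coefficient of β on a constant field is affine in the base point, so its derivative is
    -- read off from its linear part.
    have hf : (fun y : HeisenbergModel n ↦ R.oneForm y w) = fun y : HeisenbergModel n ↦
        -(symplecticLeft w y * R.oneForm 1 (0, 1)) + R.oneForm 1 w := by
      funext y
      refine (oneForm_apply_of_isLeftInvariant R hinv y w).trans ?_
      rw [symplecticForm_swap, symplecticLeft_apply]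
      ring
    have hd : HasFDerivAt (fun y : HeisenbergModel n ↦ R.oneForm y w) _ x :=
      hf ▸ (((symplecticLeft w).hasFDerivAt (x := x)).mul_const
        (R.oneForm 1 (0, 1) : ℝ)).neg.add_const (R.oneForm 1 w : ℝ)
    rw [mvfderiv_apply_eq_fderiv, hd.fderiv]
    simp [symplecticLeft_apply, mul_comm]
  have h := hDouglas (fun _ ↦ u) (fun _ ↦ v) (hsmooth u) (hsmooth v) (1 : Heisenberg n)
  have hb : VectorField.mlieBracket 𝓘(ℝ, HeisenbergModel n) (M := Heisenberg n)
      (fun _ ↦ u) (fun _ ↦ v) 1 = 0 :=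
    mlieBracket_const_const u v (1 : Heisenberg n)
  rw [hb, map_zero] at h
  have h1 := hderiv v u (1 : Heisenberg n)
  have h2 := hderiv u v (1 : Heisenberg n)
  rw [symplecticForm_swap] at h2
  have h' : -(symplecticForm u.1 v.1 * R.oneForm 1 (0, 1)) -
      -(-symplecticForm u.1 v.1 * R.oneForm 1 (0, 1)) - 0 = 0 := by
    rw [← h1, ← h2]
    exact h
  linarith

/-- In the global coordinates, a closed left-invariant `1`-form is constant. -/
theorem oneForm_eq_oneForm_one (R : RandersData 𝓘(ℝ, HeisenbergModel n) (Heisenberg n))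
    (hinv : R.toFinslerMetric.IsLeftInvariant) (hDouglas : R.IsDouglas)
    (a : Heisenberg n) (v : HeisenbergModel n) :
    R.oneForm a v = R.oneForm 1 v :=
  (oneForm_apply_of_isLeftInvariant R hinv a v).trans <| by
    rw [symplecticForm_mul_oneForm_eq_zero R hinv hDouglas v a, add_zero]

end Heisenberg

end

theorem mainTheorem11 (n : ℕ)
    (R : RandersData 𝓘(ℝ, HeisenbergModel n) (Heisenberg n))
    (hinv : R.toFinslerMetric.IsLeftInvariant)
    (hDouglas : R.IsDouglas)
    (hX : R.field ≠ 0) :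
    ¬ R.toFinslerMetric.IsWeaklySymmetric := by
  intro hws
  let b : HeisenbergModel n →L[ℝ] ℝ := R.oneForm 1
  have hb (a : Heisenberg n) (v : HeisenbergModel n) : R.oneForm a v = b v :=
    Heisenberg.oneForm_eq_oneForm_one R hinv hDouglas a v
  -- Exchanging q with the origin suffices, because b vanishes at 0.
  have hb0 (q : HeisenbergModel n) : b q = 0 := by
    obtain ⟨φ, hφ, hpq, hqp⟩ := hws (0 : HeisenbergModel n) q
    let ψ : HeisenbergModel n → HeisenbergModel n := φ
    have hψ : ContDiff ℝ ∞ ψ := contMDiff_iff_contDiff.1 φ.contMDiff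
    have hd (x y : HeisenbergModel n) : b (fderiv ℝ ψ x y) = b y := by
      have h := R.oneForm_mfderiv φ x (fun y ↦ hφ ⟨x, y⟩) y
      have hm : mfderiv 𝓘(ℝ, HeisenbergModel n) 𝓘(ℝ, HeisenbergModel n) φ x y = fderiv ℝ ψ x y :=
        DFunLike.congr_fun (mfderiv_eq_fderiv (f := ψ)) y
      rw [hm] at h
      exact (hb _ _).symm.trans (h.trans (hb _ _))
    obtain ⟨c, hc⟩ :=
      exists_apply_eq_add_of_comp_fderiv_eq b ψ (hψ.differentiable (by simp)) hd
    have h1 : b q = b 0 + c := hpq ▸ hc 0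
    have h2 : b 0 = b q + c := (congrArg b hqp).symm.trans (hc q)
    rw [map_zero] at h1 h2
    linarith
  exact hX <| R.field_eq_zero_of_oneForm fun a ↦
    ContinuousLinearMap.ext fun v ↦ (hb a v).trans (hb0 v)
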